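/- Let $m,n,C\ge 0$ be integers with $n\le m$ (for $m>0$ this is the weak/moderate interference regime $0\le n/m\le 1$), and let $q=\max\{m,n\}=m$. Consider the linear deterministic symmetric Z-interference channel over $\mathbb F_2$, $$\mathbf y_1=\mathbf D^{q-m}\mathbf x_1\oplus \mathbf D^{q-n}\mathbf x_2,\qquad \mathbf y_2=\mathbf D^{q-m}\mathbf x_2,$$ where $\mathbf x_1,\mathbf x_2\in\mathbb F_2^q$ are the inputs of transmitters 1 and 2, $\mathbf y_1,\mathbf y_2$ are the outputs at receivers 1 and 2, and $\mathbf D$ is the $q\times q$ downshift matrix ($d_{ij}=1$ if $i=j+1$ and $d_{ij}=0$ otherwise). A code of block length $N$ has independent, uniformly distributed messages $W_1$, $W_2$, and each transmitter may use private randomness independent of everything else. In each channel use $t$, transmitter 2 sends $C$ bits $\mathbf v_{21}[t]\in\mathbb F_2^C$ over a noiseless secure link to transmitter 1; $\mathbf v_{21}$ and $\mathbf x_2$ are functions of $W_2$ and the randomness of transmitter 2, and $\mathbf x_1[t]$ is a function of $W_1$, the randomness of transmitter 1 and $\mathbf v_{21}[1],\dots,\mathbf v_{21}[t]$. Receiver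 $i$ decodes $W_i$ from $\mathbf y_i^N$. A pair $(R_1,R_2)$ of nonnegative reals is achievable if there are codes of all block lengths $N$ with $\lceil 2^{NR_1}\rceil$ and $\lceil 2^{NR_2}\rceil$ messages whose probability that some receiver decodes its message wrongly tends to $0$ as $N\to\infty$; it is achievable with perfect secrecy if moreover $I(W_1;\mathbf y_2^N)=0$ and $I(W_2;\mathbf y_1^N)=0$ for every $N$. The capacity region (respectively perfect-secrecy capacity region) is the closure of the set of rate pairs achievable (respectively achievable with perfect secrecy). Then the perfect-secrecy capacity region is exactly the set of $(R_1,R_2)$ with $R_1,R_2\ge 0$ and $$R_1\le m,\qquad R_2\le m,\qquad R_1+R_2\le 2m-n+C,$$ and it coincides with the capacity region without secrecy constraints. -/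

import Mathlib

open scoped ENNReal

namespace DetZIC

/-- Binary column vectors of length `k`; the top-most level is entry `0`. -/
abbrev BitVec2 (k : ℕ) : Type := Fin k → ZMod 2

/-- The `q × q` downshift matrix over `𝔽₂`: its entry `(i, j)` is `1` iff `i = j + 1`. -/
def downshift (q : ℕ) : Matrix (Fin q) (Fin q) (ZMod 2) :=
  Matrix.of fun i j => if (i : ℕ) = (j : ℕ) + 1 then 1 else 0

/-- Channel output at receiver 1 in one channel use, `y₁ = D^(q-m) x₁ ⊕ D^(q-n) x₂`
with `q = max m n`. The lowest `q - m` entries of `x₁` never reach a receiver. -/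
def output₁ (m n : ℕ) (x₁ x₂ : BitVec2 (max m n)) : BitVec2 (max m n) :=
  (downshift (max m n) ^ (max m n - m)).mulVec x₁ +
    (downshift (max m n) ^ (max m n - n)).mulVec x₂

/-- Channel output at receiver 2 in one channel use, `y₂ = D^(q-m) x₂` with `q = max m n`.
The highest `q - m` entries are always `0`. -/
def output₂ (m n : ℕ) (x₂ : BitVec2 (max m n)) : BitVec2 (max m n) :=
  (downshift (max m n) ^ (max m n - m)).mulVec x₂

/-- A (stochastic) code of block length `N` with `M₁`, `M₂` messages for the channel with
parameters `m`, `n` and a noiseless link of `C` bits per channel use from transmitter 2 to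
transmitter 1.
The private randomness of transmitter `i` is a random variable of arbitrary law on a finite set
(all other alphabets are finite, so this covers every stochastic encoder). -/
structure Code (m n C N M₁ M₂ : ℕ) where
  /-- size of the alphabet of the private randomness of transmitter 1 -/
  k₁ : ℕ
  /-- size of the alphabet of the private randomness of transmitter 2 -/
  k₂ : ℕ
  /-- law of the private randomness of transmitter 1 -/
  p₁ : PMF (Fin k₁)
  /-- law of the private randomness of transmitter 2 -/
  p₂ : PMF (Fin k₂)
  /-- signal on the cooperative link at each time -/
  link : Fin M₂ → Fin k₂ → Fin N → BitVec2 C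
  /-- channel input of transmitter 2 at each time -/
  enc₂ : Fin M₂ → Fin k₂ → Fin N → BitVec2 (max m n)
  /-- channel input of transmitter 1 at time `t`: it depends on the own message, the own private
  randomness, and the link signal up to time `t` only (causality) -/
  enc₁ : Fin M₁ → Fin k₁ → (t : Fin N) → ({s : Fin N // s ≤ t} → BitVec2 C) →
    BitVec2 (max m n)
  /-- decoder of receiver 1 -/
  dec₁ : (Fin N → BitVec2 (max m n)) → Fin M₁
  /-- decoder of receiver 2 -/
  dec₂ : (Fin N → BitVec2 (max m n)) → Fin M₂

/-- Mutual information `I(X; Y)` under `μ`: the Kullback-Leibler divergence of the joint law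
from the product of the marginal laws. -/
noncomputable def mutualInfo {Ω α β : Type*} [MeasurableSpace Ω] [MeasurableSpace α]
    [MeasurableSpace β] (μ : MeasureTheory.Measure Ω) (X : Ω → α) (Y : Ω → β) : ℝ≥0∞ :=
  InformationTheory.klDiv (μ.map fun ω => (X ω, Y ω)) ((μ.map X).prod (μ.map Y))

namespace Code

variable {m n C N M₁ M₂ : ℕ} (c : Code m n C N M₁ M₂)

/-- Sample space: the two messages and the two private random variables. -/
abbrev Outcome : Type := (Fin M₁ × Fin M₂) × (Fin c.k₁ × Fin c.k₂)

/-- The messages are uniform; messages and private random variables are all independent. -/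
noncomputable def law : MeasureTheory.Measure c.Outcome :=
  ((ProbabilityTheory.uniformOn Set.univ).prod (ProbabilityTheory.uniformOn Set.univ)).prod
    (c.p₁.toMeasure.prod c.p₂.toMeasure)

/-- Message of user 1. -/
def W₁ (ω : c.Outcome) : Fin M₁ := ω.1.1

/-- Message of user 2. -/
def W₂ (ω : c.Outcome) : Fin M₂ := ω.1.2

/-- The block of signals sent over the cooperative link. -/
def V (ω : c.Outcome) : Fin N → BitVec2 C := c.link ω.1.2 ω.2.2

/-- The block of channel inputs of transmitter 1. -/
def X₁ (ω : c.Outcome) : Fin N → BitVec2 (max m n) :=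
  fun t => c.enc₁ ω.1.1 ω.2.1 t fun s => c.V ω s

/-- The block of channel inputs of transmitter 2. -/
def X₂ (ω : c.Outcome) : Fin N → BitVec2 (max m n) := c.enc₂ ω.1.2 ω.2.2

/-- The block of channel outputs at receiver 1. -/
def Y₁ (ω : c.Outcome) : Fin N → BitVec2 (max m n) :=
  fun t => output₁ m n (c.X₁ ω t) (c.X₂ ω t)

/-- The block of channel outputs at receiver 2. -/
def Y₂ (ω : c.Outcome) : Fin N → BitVec2 (max m n) :=
  fun t => output₂ m n (c.X₂ ω t)

/-- Average probability that at least one receiver decodes its own message wrongly. -/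
noncomputable def errorProb : ℝ≥0∞ :=
  c.law {ω | c.dec₁ (c.Y₁ ω) ≠ c.W₁ ω ∨ c.dec₂ (c.Y₂ ω) ≠ c.W₂ ω}

/-- Perfect secrecy of both messages at the unintended receivers. -/
def PerfectlySecret : Prop :=
  mutualInfo c.law c.W₁ c.Y₂ = 0 ∧ mutualInfo c.law c.W₂ c.Y₁ = 0

end Code

/-- Number of messages of a code of block length `N` and rate `R` bits per channel use. -/
noncomputable def numMessages (N : ℕ) (R : ℝ) : ℕ := ⌈(2 : ℝ) ^ ((N : ℝ) * R)⌉₊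

/-- The rate pair `R` is achievable (without secrecy constraints). -/
def IsAchievable (m n C : ℕ) (R : ℝ × ℝ) : Prop :=
  0 ≤ R.1 ∧ 0 ≤ R.2 ∧
    ∃ c : (N : ℕ) → Code m n C N (numMessages N R.1) (numMessages N R.2),
      Filter.Tendsto (fun N => (c N).errorProb) Filter.atTop (nhds 0)

/-- The rate pair `R` is achievable with perfect secrecy. -/
def IsSecrecyAchievable (m n C : ℕ) (R : ℝ × ℝ) : Prop :=
  0 ≤ R.1 ∧ 0 ≤ R.2 ∧
    ∃ c : (N : ℕ) → Code m n C N (numMessages N R.1) (numMessages N R.2),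
      (∀ N, (c N).PerfectlySecret) ∧
        Filter.Tendsto (fun N => (c N).errorProb) Filter.atTop (nhds 0)

/-- The capacity region without secrecy constraints. -/
def capacityRegion (m n C : ℕ) : Set (ℝ × ℝ) := closure {R | IsAchievable m n C R}

/-- The perfect-secrecy capacity region. -/
def secrecyCapacityRegion (m n C : ℕ) : Set (ℝ × ℝ) :=
  closure {R | IsSecrecyAchievable m n C R}

end DetZIC

namespace DetZIC

open MeasureTheory ProbabilityTheory

/-! Converse: fix the private randomness, so that the code is deterministic, and count the message
pairs decoded correctly. Receiver 1's output gives `W₁`; with the link signal it gives `X₁`, and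
subtracting `X₁` leaves the top `n` levels of `X₂`. Adjoining the `m - n` unseen levels recovers
`X₂`, hence `W₂`. So at most `2 ^ (N * (2m - n + C))` pairs are decoded
(`ncard_correctPairs_le_sum`), and `le_of_tendsto_zero` turns such counts into rate bounds.

Achievability: transmitter 2 shares its top `C` levels and transmitter 1 cancels them over `𝔽₂`.
This leaves `N * (n - C)` interfered slots (truncated subtraction). Each is either filled with
uniform noise by transmitter 1, which loses one bit of `R₁`, or silenced by transmitter 2, which
loses one bit of `R₂`. The noise is a one-time pad on the leftover interference. The code is
uncoded, error-free and perfectly secret (`exists_code`), and it meets the converse, so secrecy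
costs nothing. -/

theorem downshift_mulVec (q : ℕ) (v : BitVec2 q) (i : Fin q) :
    (downshift q).mulVec v i = if 1 ≤ (i : ℕ) then v ⟨i - 1, by omega⟩ else 0 := by
  unfold Matrix.mulVec dotProduct downshift
  split_ifs with h
  · rw [Finset.sum_eq_single ⟨i - 1, by omega⟩]
    · simp only [Matrix.of_apply]
      rw [if_pos (by omega), one_mul]
    · intro j _ hj
      simp only [Matrix.of_apply]
      rw [if_neg, zero_mul]
      intro h'
      apply hj
      ext
      simp [h']
    · simp
  · refine Finset.sum_eq_zero fun j _ => ?_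
    simp only [Matrix.of_apply]
    rw [if_neg (by omega), zero_mul]

theorem downshift_pow_mulVec (q k : ℕ) (v : BitVec2 q) (i : Fin q) :
    (downshift q ^ k).mulVec v i = if k ≤ (i : ℕ) then v ⟨i - k, by omega⟩ else 0 := by
  induction k generalizing i with
  | zero => simp
  | succ k ih =>
    rw [pow_succ', ← Matrix.mulVec_mulVec, downshift_mulVec]
    by_cases h : k + 1 ≤ (i : ℕ)
    · rw [if_pos (by omega), if_pos h, ih, if_pos (by simp; omega)]
      congr 2
      simp; omega
    · rw [if_neg h]
      by_cases h1 : 1 ≤ (i : ℕ)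
      · rw [if_pos h1, ih, if_neg (by simp; omega)]
      · rw [if_neg h1]

theorem output₂_eq {m n : ℕ} (hnm : n ≤ m) (x : BitVec2 (max m n)) : output₂ m n x = x := by
  have h : max m n - m = 0 := by omega
  rw [output₂, h, pow_zero, Matrix.one_mulVec]

theorem output₁_apply {m n : ℕ} (hnm : n ≤ m) (x₁ x₂ : BitVec2 (max m n)) (i : Fin (max m n)) :
    output₁ m n x₁ x₂ i =
      x₁ i + if m - n ≤ (i : ℕ) then x₂ ⟨i - (m - n), by omega⟩ else 0 := by
  have h : max m n - m = 0 := by omega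
  have h' : max m n - n = m - n := by omega
  rw [output₁, h, pow_zero, Matrix.one_mulVec, Pi.add_apply, h', downshift_pow_mulVec]

theorem isProbabilityMeasure_uniformOn_univ {M : ℕ} (h : 0 < M) :
    IsProbabilityMeasure (uniformOn (Set.univ : Set (Fin M))) := by
  have : NeZero M := ⟨h.ne'⟩
  exact isProbabilityMeasure_uniformOn Set.finite_univ Set.univ_nonempty

theorem uniformOn_singleton {M : ℕ} (w : Fin M) :
    uniformOn (Set.univ : Set (Fin M)) {w} = (M : ℝ≥0∞)⁻¹ := by
  simp [uniformOn_univ]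

/-! ### Converse: counting correctly decoded message pairs. -/

namespace Code

variable {m n C N M₁ M₂ : ℕ} (c : Code m n C N M₁ M₂)

theorem isProbabilityMeasure_law (h₁ : 0 < M₁) (h₂ : 0 < M₂) : IsProbabilityMeasure c.law := by
  have := isProbabilityMeasure_uniformOn_univ h₁
  have := isProbabilityMeasure_uniformOn_univ h₂
  unfold law
  infer_instance

/-- Message pairs that are decoded correctly for given private randomness. -/
def correctPairs (r : Fin c.k₁ × Fin c.k₂) : Set (Fin M₁ × Fin M₂) :=
  {w | c.dec₁ (c.Y₁ (w, r)) = w.1 ∧ c.dec₂ (c.Y₂ (w, r)) = w.2}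

/-- By Fubini the success probability averages, over the private randomness, the number of correct
pairs divided by `M₁ * M₂`. A uniform count therefore replaces Fano's inequality. -/
theorem one_sub_errorProb_le (h₁ : 0 < M₁) (h₂ : 0 < M₂) (B : ℕ)
    (hB : ∀ r, (c.correctPairs r).ncard ≤ B) :
    1 - c.errorProb ≤ B / (M₁ * M₂) := by
  have := c.isProbabilityMeasure_law h₁ h₂
  have := isProbabilityMeasure_uniformOn_univ h₁
  have := isProbabilityMeasure_uniformOn_univ h₂
  rw [errorProb, ← prob_compl_eq_one_sub (Set.toFinite _).measurableSet, law,
    Measure.prod_apply_symm (Set.toFinite _).measurableSet]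
  calc _ ≤ ∫⁻ _, (B : ℝ≥0∞) / (M₁ * M₂) ∂(c.p₁.toMeasure.prod c.p₂.toMeasure) := by
        refine lintegral_mono fun r => ?_
        have hs : (fun w => (w, r)) ⁻¹' {ω : c.Outcome | c.dec₁ (c.Y₁ ω) ≠ c.W₁ ω ∨
            c.dec₂ (c.Y₂ ω) ≠ c.W₂ ω}ᶜ = c.correctPairs r := by
          ext w
          simp [correctPairs, W₁, W₂]
        rw [hs]
        have hf : (c.correctPairs r).Finite := Set.toFinite _
        have hsing (w : Fin M₁ × Fin M₂) : ((uniformOn (Set.univ : Set (Fin M₁))).prod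
            (uniformOn (Set.univ : Set (Fin M₂)))) {w} = ((M₁ : ℝ≥0∞) * M₂)⁻¹ := by
          obtain ⟨a, b⟩ := w
          rw [← Set.singleton_prod_singleton, Measure.prod_prod, uniformOn_singleton,
            uniformOn_singleton, ENNReal.mul_inv (by simp) (by simp)]
        rw [← hf.coe_toFinset, ← sum_measure_singleton]
        simp only [hsing, Finset.sum_const, nsmul_eq_mul, ← Set.ncard_eq_toFinset_card _ hf]
        rw [ENNReal.div_eq_inv_mul, mul_comm]
        gcongr
        exact hB r
    _ = _ := by simp

/-- On correct pairs `Y₁` determines `W₁`, so `(Y₁, W₂)` is injective there. -/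
theorem ncard_correctPairs_le_left (r) :
    (c.correctPairs r).ncard ≤ 2 ^ (N * max m n) * M₂ := by
  classical
  have h := Set.ncard_le_ncard_of_injOn
    (fun w : Fin M₁ × Fin M₂ => (c.Y₁ (w, r), w.2)) (s := c.correctPairs r) (t := Set.univ)
    (by simp) (by
      rintro ⟨a, b⟩ ⟨h1, -⟩ ⟨a', b'⟩ ⟨h1', -⟩ h
      simp only [Prod.mk.injEq] at h h1 h1' ⊢
      refine ⟨?_, h.2⟩
      rw [← h1, ← h1', h.1])
  rw [Set.ncard_univ, Nat.card_eq_fintype_card] at h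
  simpa [pow_mul, pow_right_comm, mul_comm N] using h

theorem ncard_correctPairs_le_right (r) :
    (c.correctPairs r).ncard ≤ M₁ * 2 ^ (N * max m n) := by
  classical
  have h := Set.ncard_le_ncard_of_injOn
    (fun w : Fin M₁ × Fin M₂ => (w.1, c.Y₂ (w, r))) (s := c.correctPairs r) (t := Set.univ)
    (by simp) (by
      rintro ⟨a, b⟩ ⟨-, h1⟩ ⟨a', b'⟩ ⟨-, h1'⟩ h
      simp only [Prod.mk.injEq] at h h1 h1' ⊢
      refine ⟨h.1, ?_⟩
      rw [← h1, ← h1', h.2])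
  rw [Set.ncard_univ, Nat.card_eq_fintype_card] at h
  simpa [pow_mul, pow_right_comm, mul_comm N] using h

/-- The output at receiver 1, the link signals, and the levels of transmitter 2 that receiver 1
does not see determine a correctly decoded pair of messages. -/
theorem ncard_correctPairs_le_sum (hnm : n ≤ m) (r) :
    (c.correctPairs r).ncard ≤ 2 ^ (N * (max m n + C + (m - n))) := by
  classical
  have h := Set.ncard_le_ncard_of_injOn
    (fun w : Fin M₁ × Fin M₂ => (c.Y₁ (w, r), c.V (w, r),
      fun (t : Fin N) (j : Fin (m - n)) => c.X₂ (w, r) t ⟨n + j, by omega⟩))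
    (s := c.correctPairs r) (t := Set.univ)
    (by simp) (by
      rintro ⟨a, b⟩ ⟨h1, h2⟩ ⟨a', b'⟩ ⟨h1', h2'⟩ h
      simp only [Prod.mk.injEq] at h h1 h1' h2 h2' ⊢
      obtain ⟨hY, hV, hX⟩ := h
      have ha : a = a' := by rw [← h1, ← h1', hY]
      refine ⟨ha, ?_⟩
      have hX₁ : c.X₁ ((a, b), r) = c.X₁ ((a', b'), r) := by
        subst ha
        unfold X₁
        simp only [hV]
      have hX₂ : c.X₂ ((a, b), r) = c.X₂ ((a', b'), r) := by
        funext t i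
        by_cases hi : (i : ℕ) < n
        -- Level `i < n` of transmitter 2 arrives at receiver 1 on level `i + (m - n)`, where the
        -- common `X₁` cancels.
        · have := congrFun (congrFun hY t) ⟨i + (m - n), by omega⟩
          simp only [Y₁, output₁_apply hnm, hX₁] at this
          simpa using this
        · have := congrFun (congrFun hX t) ⟨i - n, by omega⟩
          simp only at this
          convert this using 2 <;> (ext; simp; omega)
      rw [← h2, ← h2']
      unfold Y₂
      rw [hX₂])
  rw [Set.ncard_univ, Nat.card_eq_fintype_card] at h
  refine h.trans (le_of_eq ?_)
  simp only [Fintype.card_prod, Fintype.card_pi, ZMod.card, Finset.prod_const, Finset.card_univ,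
    Fintype.card_fin]
  ring

end Code

theorem numMessages_pos (N : ℕ) (R : ℝ) : 0 < numMessages N R :=
  Nat.ceil_pos.2 (by positivity)

theorem rpow_le_numMessages (N : ℕ) (R : ℝ) : (2 : ℝ) ^ ((N : ℝ) * R) ≤ numMessages N R :=
  Nat.le_ceil _

/-- If the probability of correct decoding is at most `2 ^ (N * S) / 2 ^ (N * R)` and tends to
`1`, then `R ≤ S`. -/
theorem le_of_tendsto_zero {e : ℕ → ℝ≥0∞} (he : Filter.Tendsto e Filter.atTop (nhds 0))
    {R : ℝ} {S : ℕ} (D : ℕ → ℕ) (hD : ∀ N : ℕ, (2 : ℝ) ^ (N * R) ≤ D N)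
    (h : ∀ N, 1 - e N ≤ ((2 ^ (N * S) : ℕ) : ℝ≥0∞) / D N) : R ≤ S := by
  by_contra! hlt
  have hev : ∀ᶠ N in Filter.atTop, e N < 2⁻¹ := he.eventually_lt_const (by simp)
  obtain ⟨N₀, hN₀⟩ := Filter.eventually_atTop.1 hev
  obtain ⟨N₁, hN₁⟩ := exists_nat_gt (1 / (R - S))
  -- At this `N` the success probability is at least `1/2`, while the count bounds it by `2 ^ (-N *
  -- (R - S)) < 1/2`.
  set N := max N₀ N₁
  have hN : 1 < N * (R - S) := by
    rw [div_lt_iff₀ (by linarith)] at hN₁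
    have : (N₁ : ℝ) ≤ N := by exact_mod_cast le_max_right _ _
    nlinarith
  have h1 : (2 : ℝ≥0∞)⁻¹ ≤ ((2 ^ (N * S) : ℕ) : ℝ≥0∞) / D N := by
    refine le_trans ?_ (h N)
    rw [← ENNReal.one_sub_inv_two]
    exact tsub_le_tsub_left (hN₀ N (le_max_left _ _)).le _
  have hpos : (0 : ℝ) < D N := lt_of_lt_of_le (by positivity) (hD N)
  have hDN : D N ≠ 0 := by
    rintro h0
    simp [h0] at hpos
  rw [ENNReal.le_div_iff_mul_le (by simp [hDN]) (by simp), mul_comm, ← div_eq_mul_inv,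
    ENNReal.div_le_iff_le_mul (by simp) (by simp)] at h1
  have h2 : D N ≤ 2 ^ (N * S) * 2 := by exact_mod_cast h1
  have h3 : (D N : ℝ) ≤ 2 ^ (N * S) * 2 := by exact_mod_cast h2
  have h4 : (2 : ℝ) ^ (N * R) ≤ 2 ^ ((N * S + 1 : ℕ) : ℝ) := by
    rw [Real.rpow_natCast, pow_succ]
    exact (hD N).trans h3
  rw [Real.rpow_le_rpow_left_iff (by norm_num)] at h4
  push_cast at h4
  linarith

theorem IsAchievable.mem_outerBound {m n C : ℕ} (hnm : n ≤ m) {R : ℝ × ℝ}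
    (h : IsAchievable m n C R) :
    0 ≤ R.1 ∧ 0 ≤ R.2 ∧ R.1 ≤ (m : ℝ) ∧ R.2 ≤ (m : ℝ) ∧
      R.1 + R.2 ≤ 2 * (m : ℝ) - (n : ℝ) + (C : ℝ) := by
  obtain ⟨h₁, h₂, c, hc⟩ := h
  have hmax : max m n = m := max_eq_left hnm
  refine ⟨h₁, h₂, ?_, ?_, ?_⟩
  · refine le_of_tendsto_zero hc (fun N => numMessages N R.1) (fun N => rpow_le_numMessages N _)
      fun N => ((c N).one_sub_errorProb_le (numMessages_pos _ _) (numMessages_pos _ _) _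
        (c N).ncard_correctPairs_le_left).trans (le_of_eq ?_)
    rw [hmax, Nat.cast_mul]
    exact ENNReal.mul_div_mul_right _ _ (by simpa using (numMessages_pos _ _).ne') (by simp)
  · refine le_of_tendsto_zero hc (fun N => numMessages N R.2) (fun N => rpow_le_numMessages N _)
      fun N => ((c N).one_sub_errorProb_le (numMessages_pos _ _) (numMessages_pos _ _) _
        (c N).ncard_correctPairs_le_right).trans (le_of_eq ?_)
    rw [hmax, Nat.cast_mul]
    exact ENNReal.mul_div_mul_left _ _ (by simpa using (numMessages_pos _ _).ne') (by simp)
  · have h := le_of_tendsto_zero hc (R := R.1 + R.2) (S := max m n + C + (m - n))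
      (fun N => numMessages N R.1 * numMessages N R.2)
      (fun N => by
        rw [mul_add, Real.rpow_add (by norm_num)]
        push_cast
        gcongr <;> exact rpow_le_numMessages N _)
      fun N => ((c N).one_sub_errorProb_le (numMessages_pos _ _) (numMessages_pos _ _) _
        ((c N).ncard_correctPairs_le_sum hnm)).trans (le_of_eq (by rw [Nat.cast_mul]))
    rw [hmax] at h
    push_cast [Nat.cast_sub hnm] at h
    linarith

/-! ### Independence and secrecy criteria. -/

theorem mutualInfo_eq_zero {Ω α β : Type*} [MeasurableSpace Ω] [MeasurableSpace α]
    [MeasurableSpace β] {μ : Measure Ω} [IsProbabilityMeasure μ] {X : Ω → α} {Y : Ω → β}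
    (hX : AEMeasurable X μ) (hY : AEMeasurable Y μ) (h : IndepFun X Y μ) :
    mutualInfo μ X Y = 0 := by
  rw [mutualInfo, (indepFun_iff_map_prod_eq_prod_map_map hX hY).1 h]
  have := Measure.isProbabilityMeasure_map hX
  have := Measure.isProbabilityMeasure_map hY
  exact InformationTheory.klDiv_self _

theorem map_equiv_eq_self {α : Type*} [Countable α] [MeasurableSpace α]
    [DiscreteMeasurableSpace α] (μ : Measure α) (e : α ≃ α) (h : ∀ a, μ {e a} = μ {a}) :
    μ.map e = μ := by
  refine Measure.ext_of_singleton fun a => ?_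
  rw [Measure.map_apply .of_discrete (measurableSet_singleton a), ← h]
  have : (e ⁻¹' {a}) = {e.symm a} := by
    ext x
    simp [Equiv.eq_symm_apply]
  rw [this, ← h (e.symm a), e.apply_symm_apply, h]

/-- The factors `ν` and `ρ` need not be known to be the marginals: having total mass one forces it.
-/
theorem indepFun_of_map_eq_prod {Ω α β : Type*} [MeasurableSpace Ω] [MeasurableSpace α]
    [MeasurableSpace β] {μ : Measure Ω} {X : Ω → α} {Y : Ω → β} (hX : Measurable X)
    (hY : Measurable Y) {ν : Measure α} {ρ : Measure β} [IsProbabilityMeasure ν]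
    [IsProbabilityMeasure ρ] (h : μ.map (fun ω => (X ω, Y ω)) = ν.prod ρ) : IndepFun X Y μ := by
  have key (s : Set α) (t : Set β) (hs : MeasurableSet s) (ht : MeasurableSet t) :
      μ (X ⁻¹' s ∩ Y ⁻¹' t) = ν s * ρ t := by
    rw [← Measure.prod_prod, ← h, Measure.map_apply (hX.prodMk hY) (hs.prod ht)]
    rfl
  rw [indepFun_iff_measure_inter_preimage_eq_mul]
  intro s t hs ht
  have h1 := key s Set.univ hs .univ
  have h2 := key Set.univ t .univ ht
  simp only [Set.preimage_univ, Set.inter_univ, Set.univ_inter, measure_univ, mul_one,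
    one_mul] at h1 h2
  rw [key s t hs ht, h1, h2]

namespace Code

variable {m n C N M₁ M₂ : ℕ} (c : Code m n C N M₁ M₂)

theorem law_singleton (ω : c.Outcome) :
    c.law {ω} = (M₁ : ℝ≥0∞)⁻¹ * (M₂ : ℝ≥0∞)⁻¹ * (c.p₁ ω.2.1 * c.p₂ ω.2.2) := by
  have h1 : SFinite (uniformOn (Set.univ : Set (Fin M₁))) := by unfold uniformOn; infer_instance
  have h2 : SFinite (uniformOn (Set.univ : Set (Fin M₂))) := by unfold uniformOn; infer_instance
  obtain ⟨⟨a, b⟩, x, y⟩ := ω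
  rw [law, ← Set.singleton_prod_singleton, Measure.prod_prod, ← Set.singleton_prod_singleton,
    ← Set.singleton_prod_singleton, Measure.prod_prod, Measure.prod_prod, uniformOn_singleton,
    uniformOn_singleton, PMF.toMeasure_apply_singleton _ _ (measurableSet_singleton _),
    PMF.toMeasure_apply_singleton _ _ (measurableSet_singleton _)]

/-- The second message is independent of everything else. -/
theorem indepFun_W₂ (h₁ : 0 < M₁) (h₂ : 0 < M₂) :
    IndepFun c.W₂ (fun ω : c.Outcome => (ω.1.1, ω.2)) c.law := by
  have := isProbabilityMeasure_uniformOn_univ h₁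
  have := isProbabilityMeasure_uniformOn_univ h₂
  refine indepFun_of_map_eq_prod .of_discrete .of_discrete (ν := uniformOn Set.univ)
    (ρ := (uniformOn Set.univ).prod (c.p₁.toMeasure.prod c.p₂.toMeasure)) ?_
  refine Measure.ext_of_singleton fun ⟨b, a, r⟩ => ?_
  rw [Measure.map_apply .of_discrete (measurableSet_singleton _)]
  have : (fun ω : c.Outcome => (c.W₂ ω, ω.1.1, ω.2)) ⁻¹' {(b, a, r)} = {((a, b), r)} := by
    ext ⟨⟨a', b'⟩, r'⟩
    simp [W₂]
    tauto
  rw [this, law]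
  simp only [← Set.singleton_prod_singleton, Measure.prod_prod]
  ring

/-- The first message is independent of everything else. -/
theorem indepFun_W₁ (h₁ : 0 < M₁) (h₂ : 0 < M₂) :
    IndepFun c.W₁ (fun ω : c.Outcome => (ω.1.2, ω.2)) c.law := by
  have := isProbabilityMeasure_uniformOn_univ h₁
  have := isProbabilityMeasure_uniformOn_univ h₂
  refine indepFun_of_map_eq_prod .of_discrete .of_discrete (ν := uniformOn Set.univ)
    (ρ := (uniformOn Set.univ).prod (c.p₁.toMeasure.prod c.p₂.toMeasure)) ?_
  refine Measure.ext_of_singleton fun ⟨a, b, r⟩ => ?_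
  rw [Measure.map_apply .of_discrete (measurableSet_singleton _)]
  have : (fun ω : c.Outcome => (c.W₁ ω, ω.1.2, ω.2)) ⁻¹' {(a, b, r)} = {((a, b), r)} := by
    ext ⟨⟨a', b'⟩, r'⟩
    simp [W₁, and_assoc]
  rw [this, law]
  simp only [← Set.singleton_prod_singleton, Measure.prod_prod, mul_assoc]

/-- The output at receiver 2 does not depend on the first message at all. -/
theorem mutualInfo_W₁_Y₂ (h₁ : 0 < M₁) (h₂ : 0 < M₂) :
    mutualInfo c.law c.W₁ c.Y₂ = 0 := by
  have := c.isProbabilityMeasure_law h₁ h₂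
  let g : Fin M₂ × Fin c.k₁ × Fin c.k₂ → Fin N → BitVec2 (max m n) :=
    fun x t => output₂ m n (c.enc₂ x.1 x.2.2 t)
  have hi := (c.indepFun_W₁ h₁ h₂).comp (φ := id) (ψ := g) .of_discrete .of_discrete
  have hY : g ∘ (fun ω : c.Outcome => (ω.1.2, ω.2)) = c.Y₂ := rfl
  rw [hY, Function.id_comp] at hi
  exact mutualInfo_eq_zero .of_discrete .of_discrete hi

/-- The second message is kept secret if its effect on the output at receiver 1 is that of a
law-preserving permutation of the private randomness of transmitter 1. -/
theorem mutualInfo_W₂_Y₁_of_equiv (h₁ : 0 < M₁) (h₂ : 0 < M₂) (e : Fin M₂ → Fin c.k₁ ≃ Fin c.k₁)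
    (he : ∀ w x, c.p₁ (e w x) = c.p₁ x)
    (g : Fin M₁ × Fin c.k₁ → Fin N → BitVec2 (max m n))
    (hg : ∀ ω : c.Outcome, c.Y₁ ω = g (ω.1.1, e ω.1.2 ω.2.1)) :
    mutualInfo c.law c.W₂ c.Y₁ = 0 := by
  have := c.isProbabilityMeasure_law h₁ h₂
  refine mutualInfo_eq_zero .of_discrete .of_discrete ?_
  -- `T` fixes both messages and preserves the law, and `Y₁` is a function of `W₁` and the
  -- randomness of transmitter 1 composed with `T`. Independence from `W₂` is thus pulled back along
  -- `T`.
  let T : c.Outcome ≃ c.Outcome :=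
    { toFun := fun ω => (ω.1, e ω.1.2 ω.2.1, ω.2.2)
      invFun := fun ω => (ω.1, (e ω.1.2).symm ω.2.1, ω.2.2)
      left_inv := fun ω => by simp
      right_inv := fun ω => by simp }
  have hT : c.law.map T = c.law := map_equiv_eq_self _ _ fun ω => by
    rw [law_singleton, law_singleton]
    simp [T, he]
  have hi : IndepFun c.W₂ (fun ω : c.Outcome => g (ω.1.1, ω.2.1)) c.law :=
    (c.indepFun_W₂ h₁ h₂).comp (φ := id) (ψ := fun x : Fin M₁ × Fin c.k₁ × Fin c.k₂ => g (x.1, x.2.1))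
      .of_discrete .of_discrete
  rw [← hT, indepFun_iff_measure_inter_preimage_eq_mul] at hi
  rw [indepFun_iff_measure_inter_preimage_eq_mul]
  intro s t hs ht
  have := hi s t hs ht
  rw [Measure.map_apply .of_discrete (Set.toFinite _).measurableSet,
    Measure.map_apply .of_discrete (Set.toFinite _).measurableSet,
    Measure.map_apply .of_discrete (Set.toFinite _).measurableSet] at this
  have hY : c.Y₁ = fun ω => g (ω.1.1, e ω.1.2 ω.2.1) := funext hg
  rw [hY]
  exact this

end Code

/-! ### Cancellation-and-jamming codes. -/

/-- Blocks of `N` binary vectors of length `q`. -/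
abbrev Block (N q : ℕ) : Type := Fin N → Fin q → ZMod 2

/-- Contribution, at receiver 1, of the levels of transmitter 2 that are not cancelled with the
help of `C` link bits. -/
def residual (d C : ℕ) {N q : ℕ} (x : Block N q) : Block N q := fun t j =>
  if d ≤ (j : ℕ) ∧ C ≤ (j : ℕ) - d then x t ⟨j - d, by omega⟩ else 0

/-- Overwrite the slots in `B` of the block `x` by those of `r`. -/
def jam {N q : ℕ} (B : Finset (Fin N × Fin q)) (x r : Block N q) : Block N q := fun t j =>
  if (t, j) ∈ B then r t j else x t j

/-- Cancellation-and-jamming code: transmitter 2 shares its highest `C` levels, transmitter 1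
cancels their interference and sends uniform noise in the slots `B`. -/
noncomputable def jammingCode (m n C : ℕ) {N M₁ M₂ : ℕ} [NeZero M₁] [NeZero M₂]
    (B : Finset (Fin N × Fin (max m n))) (e₁ : Fin M₁ → Block N (max m n))
    (e₂ : Fin M₂ → Block N (max m n)) : Code m n C N M₁ M₂ where
  k₁ := Fintype.card (Block N (max m n))
  k₂ := 1
  p₁ := (PMF.uniformOfFintype (Block N (max m n))).map (Fintype.equivFin _)
  p₂ := PMF.pure 0
  link w _ t l := if h : (l : ℕ) < max m n then e₂ w t ⟨l, h⟩ else 0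
  enc₂ w _ := e₂ w
  enc₁ w r t v j := jam B (e₁ w) ((Fintype.equivFin _).symm r) t j +
    if h : m - n ≤ (j : ℕ) ∧ (j : ℕ) - (m - n) < C then v ⟨t, le_rfl⟩ ⟨j - (m - n), h.2⟩ else 0
  dec₁ y := Function.invFun e₁ (jam B y 0)
  dec₂ y := Function.invFun e₂ y

theorem map_uniformOfFintype_apply {α β : Type*} [Fintype α] [Nonempty α] (e : α ≃ β) (x : α) :
    (PMF.uniformOfFintype α).map e (e x) = (Fintype.card α : ℝ≥0∞)⁻¹ := by
  rw [PMF.map_apply, tsum_eq_single x]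
  · simp
  · intro y hy
    simp [hy.symm]

section

variable {m n C N M₁ M₂ : ℕ} [NeZero M₁] [NeZero M₂]
  {B : Finset (Fin N × Fin (max m n))} {e₁ : Fin M₁ → Block N (max m n)}
  {e₂ : Fin M₂ → Block N (max m n)}

theorem jammingCode_Y₁ (hnm : n ≤ m) (ω : (jammingCode m n C B e₁ e₂).Outcome) :
    (jammingCode m n C B e₁ e₂).Y₁ ω =
      jam B (e₁ ω.1.1) ((Fintype.equivFin _).symm ω.2.1) +
        residual (m - n) C (e₂ ω.1.2) := by
  funext t j
  have hj : (j : ℕ) - (m - n) < max m n := by omega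
  simp only [Code.Y₁, output₁_apply hnm, Code.X₁, Code.X₂, Code.V, jammingCode, residual,
    Pi.add_apply, hj, dif_pos]
  by_cases h1 : m - n ≤ (j : ℕ)
  · by_cases h2 : (j : ℕ) - (m - n) < C
    · simp [h1, h2, add_assoc, CharTwo.add_self_eq_zero]
    · simp [h1, h2, not_lt.1 h2]
  · simp [h1]

theorem jammingCode_Y₂ (hnm : n ≤ m) (ω : (jammingCode m n C B e₁ e₂).Outcome) :
    (jammingCode m n C B e₁ e₂).Y₂ ω = e₂ ω.1.2 := by
  funext t
  exact output₂_eq hnm _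

/-- Noise and leftover interference both live in `B`, where `e₁` vanishes, so receiver 1 loses
nothing by erasing `B`. -/
theorem jammingCode_errorProb (hnm : n ≤ m) (h₁ : Function.Injective e₁)
    (h₂ : Function.Injective e₂) (hB : ∀ w t j, (t, j) ∈ B → e₁ w t j = 0)
    (hr : ∀ w t j, (t, j) ∉ B → residual (m - n) C (e₂ w) t j = 0) :
    (jammingCode m n C B e₁ e₂).errorProb = 0 := by
  unfold Code.errorProb
  convert measure_empty (μ := (jammingCode m n C B e₁ e₂).law)
  refine Set.eq_empty_of_forall_notMem fun ω => ?_
  simp only [Set.mem_ofPred_eq, not_or, not_not]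
  rw [jammingCode_Y₁ hnm, jammingCode_Y₂ hnm]
  refine ⟨?_, Function.leftInverse_invFun h₂ _⟩
  refine Eq.trans ?_ (Function.leftInverse_invFun h₁ _)
  change Function.invFun e₁ _ = _
  congr 1
  funext t j
  by_cases h : (t, j) ∈ B
  · simp [jam, h, hB]
  · simp [jam, h, hr, Code.W₁]

/-- One-time pad: since the residual is supported on `B`, adding it amounts to translating the
uniform noise block, which preserves its law. -/
theorem jammingCode_perfectlySecret (hnm : n ≤ m)
    (hr : ∀ w t j, (t, j) ∉ B → residual (m - n) C (e₂ w) t j = 0) :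
    (jammingCode m n C B e₁ e₂).PerfectlySecret := by
  have h₁ : 0 < M₁ := NeZero.pos _
  have h₂ : 0 < M₂ := NeZero.pos _
  refine ⟨Code.mutualInfo_W₁_Y₂ _ h₁ h₂, Code.mutualInfo_W₂_Y₁_of_equiv _ h₁ h₂
    (fun w => (Fintype.equivFin (Block N (max m n))).symm.trans
      ((Equiv.addRight (residual (m - n) C (e₂ w))).trans (Fintype.equivFin _))) ?_
    (fun x => jam B (e₁ x.1) ((Fintype.equivFin _).symm x.2)) ?_⟩
  · have hp (x) : (jammingCode m n C B e₁ e₂).p₁ x =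
        (Fintype.card (Block N (max m n)) : ℝ≥0∞)⁻¹ := by
      obtain ⟨x, rfl⟩ := (Fintype.equivFin (Block N (max m n))).surjective x
      exact map_uniformOfFintype_apply _ x
    intro w x
    rw [hp, hp]
  · intro ω
    rw [jammingCode_Y₁ hnm]
    funext t j
    by_cases h : (t, j) ∈ B
    · have hx (r : Block N (max m n)) : (Fintype.equivFin (Block N (max m n))).symm
          (((Fintype.equivFin (Block N (max m n))).symm.trans
            ((Equiv.addRight r).trans (Fintype.equivFin _))) ω.2.1) =
          (Fintype.equivFin (Block N (max m n))).symm ω.2.1 + r :=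
        Equiv.symm_apply_apply _ _
      simp only [jam, h, if_true, Pi.add_apply]
      exact (congrFun (congrFun (hx _) t) j).symm
    · simp [jam, h, hr]

end

/-- A block code with few enough messages can be supported on a prescribed set of slots. -/
theorem exists_injective_block {N q M : ℕ} (B : Finset (Fin N × Fin q)) {k : ℕ}
    (hM : M ≤ 2 ^ k) (hk : k + B.card ≤ N * q) :
    ∃ e : Fin M → Block N q, Function.Injective e ∧ ∀ w t j, (t, j) ∈ B → e w t j = 0 := by
  have hcard : Fintype.card (Fin M) ≤ Fintype.card ({x // x ∈ Bᶜ} → ZMod 2) := by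
    have hc : Bᶜ.card = N * q - B.card := by simp [Finset.card_compl]
    rw [Fintype.card_fun, Fintype.card_coe, hc, Fintype.card_fin, ZMod.card]
    exact hM.trans (Nat.pow_le_pow_right (by norm_num) (by omega))
  obtain ⟨f⟩ := Function.Embedding.nonempty_of_card_le hcard
  refine ⟨fun w t j => if h : (t, j) ∈ Bᶜ then f w ⟨_, h⟩ else 0, fun w w' h => ?_, ?_⟩
  · refine f.injective (funext fun ⟨⟨t, j⟩, hx⟩ => ?_)
    have := congrFun (congrFun h t) j
    simpa only [hx, dif_pos] using this
  · intro w t j h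
    simp [h]

/-- Slots at receiver 1 that are hit by interference not cancelled with `C` link bits. -/
def interfered (N q d C : ℕ) : Finset (Fin N × Fin q) :=
  Finset.univ ×ˢ Finset.univ.filter fun j : Fin q => d + C ≤ j

theorem card_interfered (N q d C : ℕ) : (interfered N q d C).card = N * (q - (d + C)) := by
  rw [interfered, Finset.card_product, Finset.card_univ, Fintype.card_fin]
  congr 1
  have := Fin.card_filter_val_lt (n := q) (m := d + C)
  have h2 := Finset.card_filter_add_card_filter_not (s := (Finset.univ : Finset (Fin q)))
    (p := fun j : Fin q => (j : ℕ) < d + C)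
  simp only [not_lt, Finset.card_univ, Fintype.card_fin] at h2
  omega

/-- Error-free perfectly secret codes exist if the numbers of message bits satisfy the bounds. -/
theorem exists_code {m n C N M₁ M₂ k₁ k₂ : ℕ} (hnm : n ≤ m) (hM₁ : 0 < M₁) (hM₂ : 0 < M₂)
    (h₁ : M₁ ≤ 2 ^ k₁) (h₂ : M₂ ≤ 2 ^ k₂) (hk₁ : k₁ ≤ N * m) (hk₂ : k₂ ≤ N * m)
    (hk : k₁ + k₂ + N * (n - C) ≤ 2 * (N * m)) :
    ∃ c : Code m n C N M₁ M₂, c.PerfectlySecret ∧ c.errorProb = 0 := by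
  have : NeZero M₁ := ⟨hM₁.ne'⟩
  have : NeZero M₂ := ⟨hM₂.ne'⟩
  have hmax : max m n = m := max_eq_left hnm
  have hJ := card_interfered N (max m n) (m - n) C
  have hNm : N * max m n = N * m := by rw [hmax]
  have hsub : max m n - (m - n + C) = n - C := by omega
  rw [hsub] at hJ
  -- Jam as many interfered slots as message 1 can spare; the sum bound then leaves enough slots for
  -- message 2.
  obtain ⟨B, hBJ, hB⟩ := Finset.exists_subset_card_eq
    (s := interfered N (max m n) (m - n) C) (n := min (N * (n - C)) (N * m - k₁))
    (by rw [hJ]; exact min_le_left _ _)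
  -- Slots of transmitter 2 whose uncancelled interference would land outside `B`; they are kept
  -- silent.
  let A : Finset (Fin N × Fin (max m n)) :=
    (interfered N (max m n) (m - n) C \ B).image fun x => (x.1, ⟨x.2 - (m - n), by omega⟩)
  have hA : A.card ≤ N * (n - C) - B.card := by
    refine Finset.card_image_le.trans (le_of_eq ?_)
    rw [Finset.card_sdiff_of_subset hBJ, hJ]
  obtain ⟨e₁, he₁, hs₁⟩ := exists_injective_block B h₁ (le_trans (b := N * m) (by omega) hNm.ge)
  obtain ⟨e₂, he₂, hs₂⟩ := exists_injective_block A h₂ (le_trans (b := N * m) (by omega) hNm.ge)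
  have hr : ∀ w t j, (t, j) ∉ B → residual (m - n) C (e₂ w) t j = 0 := by
    intro w t j hj
    unfold residual
    split_ifs with h
    · refine hs₂ _ _ _ (Finset.mem_image.2 ⟨(t, j), ?_, rfl⟩)
      simp [interfered, hj]
      omega
    · rfl
  exact ⟨jammingCode m n C B e₁ e₂, jammingCode_perfectlySecret hnm hr,
    jammingCode_errorProb hnm he₁ he₂ hs₁ hr⟩

/-- Filler for short block lengths, where secrecy is still required but errors are allowed: all
codewords are zero. -/
theorem exists_perfectlySecret_code {m n C N M₁ M₂ : ℕ} (hnm : n ≤ m) (hM₁ : 0 < M₁)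
    (hM₂ : 0 < M₂) : ∃ c : Code m n C N M₁ M₂, c.PerfectlySecret := by
  have : NeZero M₁ := ⟨hM₁.ne'⟩
  have : NeZero M₂ := ⟨hM₂.ne'⟩
  refine ⟨jammingCode m n C ∅ 0 0, jammingCode_perfectlySecret hnm ?_⟩
  intro w t j _
  simp [residual]

/-! ### Passage to rates and closure. -/

theorem numMessages_le (N : ℕ) (R : ℝ) : numMessages N R ≤ 2 ^ ⌈(N : ℝ) * R⌉₊ := by
  refine Nat.ceil_le.2 ?_
  push_cast
  rw [← Real.rpow_natCast]
  exact Real.rpow_le_rpow_of_exponent_le (by norm_num) (Nat.le_ceil _)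

theorem isSecrecyAchievable_of_lt {m n C : ℕ} (hnm : n ≤ m) {R : ℝ × ℝ} (h₁ : 0 ≤ R.1)
    (h₂ : 0 ≤ R.2) (hm₁ : R.1 ≤ m) (hm₂ : R.2 ≤ m)
    (h : R.1 + R.2 + ((n - C : ℕ) : ℝ) < 2 * m) :
    IsSecrecyAchievable m n C R := by
  have hex (N : ℕ) : ∃ c : Code m n C N (numMessages N R.1) (numMessages N R.2),
      c.PerfectlySecret ∧
        (2 ≤ N * (2 * m - (R.1 + R.2 + ((n - C : ℕ) : ℝ))) → c.errorProb = 0) := by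
    -- Rounding the two message lengths up costs less than two bits in total.
    by_cases hN : 2 ≤ N * (2 * m - (R.1 + R.2 + ((n - C : ℕ) : ℝ)))
    · have hN0 : (0 : ℝ) ≤ N := by positivity
      obtain ⟨c, hc, hc'⟩ := exists_code (N := N) (C := C) hnm (numMessages_pos N R.1)
        (numMessages_pos N R.2) (numMessages_le N R.1) (numMessages_le N R.2)
        (Nat.ceil_le.2 (by push_cast; gcongr)) (Nat.ceil_le.2 (by push_cast; gcongr)) (by
          have c1 := Nat.ceil_lt_add_one (mul_nonneg hN0 h₁)
          have c2 := Nat.ceil_lt_add_one (mul_nonneg hN0 h₂)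
          have : ((⌈(N : ℝ) * R.1⌉₊ + ⌈(N : ℝ) * R.2⌉₊ + N * (n - C) : ℕ) : ℝ) ≤
              (2 * (N * m) : ℕ) := by
            push_cast
            linarith
          exact_mod_cast this)
      exact ⟨c, hc, fun _ => hc'⟩
    · obtain ⟨c, hc⟩ := exists_perfectlySecret_code (N := N) (C := C) hnm (numMessages_pos N R.1)
        (numMessages_pos N R.2)
      exact ⟨c, hc, fun h => absurd h hN⟩
  choose c hc hc' using hex
  refine ⟨h₁, h₂, c, hc, ?_⟩
  refine tendsto_const_nhds.congr' ?_
  obtain ⟨N₀, hN₀⟩ := exists_nat_gt (2 / (2 * m - (R.1 + R.2 + ((n - C : ℕ) : ℝ))))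
  filter_upwards [Filter.eventually_ge_atTop N₀] with N hN
  refine (hc' N ?_).symm
  rw [div_lt_iff₀ (by linarith)] at hN₀
  refine hN₀.le.trans ?_
  have : (N₀ : ℝ) ≤ N := by exact_mod_cast hN
  gcongr

theorem outerBound_subset {m n C : ℕ} (hnm : n ≤ m) {R : ℝ × ℝ} (h₁ : 0 ≤ R.1) (h₂ : 0 ≤ R.2)
    (hm₁ : R.1 ≤ m) (hm₂ : R.2 ≤ m) (h : R.1 + R.2 ≤ 2 * (m : ℝ) - n + C) :
    R ∈ secrecyCapacityRegion m n C := by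
  have hsum : R.1 + R.2 + ((n - C : ℕ) : ℝ) ≤ 2 * m := by
    rcases le_total C n with hC | hC
    · rw [Nat.cast_sub hC]
      linarith
    · rw [Nat.sub_eq_zero_of_le hC]
      push_cast
      linarith
  have hn : ((n - C : ℕ) : ℝ) ≤ m := by exact_mod_cast (Nat.sub_le _ _).trans hnm
  have hlim : Filter.Tendsto (fun s : ℝ => s • R) (nhdsWithin 1 (Set.Iio 1)) (nhds R) := by
    have : Filter.Tendsto (fun s : ℝ => s • R) (nhds 1) (nhds ((1 : ℝ) • R)) :=
      (continuous_id.smul continuous_const).tendsto 1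
    rw [one_smul] at this
    exact this.mono_left nhdsWithin_le_nhds
  refine mem_closure_of_tendsto hlim ?_
  filter_upwards [Ioo_mem_nhdsLT (zero_lt_one (α := ℝ))] with s ⟨hs0, hs1⟩
  -- Scaling by `s < 1` makes the sum bound strict only for `m > 0`; for `m = 0` the only rate pair
  -- is zero, with a single message each.
  rcases Nat.eq_zero_or_pos m with rfl | hm
  · have hR : s • R = 0 := by
      rw [Nat.cast_zero] at hm₁ hm₂
      have h0 : R = 0 := Prod.ext (hm₁.antisymm h₁) (hm₂.antisymm h₂)
      rw [h0, smul_zero]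
    rw [hR]
    have hnum (N : ℕ) : numMessages N 0 ≤ 2 ^ 0 := by simp [numMessages]
    choose c hc hc' using fun N : ℕ => exists_code (C := C) hnm (numMessages_pos N 0)
      (numMessages_pos N 0) (hnum N) (hnum N) (Nat.zero_le _) (Nat.zero_le _)
      (by simp [Nat.le_zero.1 hnm])
    exact ⟨le_rfl, le_rfl, c, hc, tendsto_const_nhds.congr fun N => (hc' N).symm⟩
  · have hm' : (0 : ℝ) < m := by exact_mod_cast hm
    refine isSecrecyAchievable_of_lt hnm ?_ ?_ ?_ ?_ ?_ <;>
      simp only [Prod.smul_fst, Prod.smul_snd, smul_eq_mul]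
    · positivity
    · positivity
    · nlinarith
    · nlinarith
    -- The left side is at most `2ms + (1 - s)(n - C) ≤ 2ms + (1 - s)m < 2m`.
    · nlinarith

end DetZIC

theorem theorem1 (m n C : ℕ) (hnm : n ≤ m) :
    DetZIC.secrecyCapacityRegion m n C =
        {R : ℝ × ℝ | 0 ≤ R.1 ∧ 0 ≤ R.2 ∧ R.1 ≤ (m : ℝ) ∧ R.2 ≤ (m : ℝ) ∧
          R.1 + R.2 ≤ 2 * (m : ℝ) - (n : ℝ) + (C : ℝ)} ∧
      DetZIC.capacityRegion m n C = DetZIC.secrecyCapacityRegion m n C := by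
  have hsub : DetZIC.secrecyCapacityRegion m n C ⊆ DetZIC.capacityRegion m n C :=
    closure_mono fun R ⟨h₁, h₂, c, _, hc⟩ => ⟨h₁, h₂, c, hc⟩
  have hclosed : IsClosed {R : ℝ × ℝ | 0 ≤ R.1 ∧ 0 ≤ R.2 ∧ R.1 ≤ (m : ℝ) ∧ R.2 ≤ (m : ℝ) ∧
      R.1 + R.2 ≤ 2 * (m : ℝ) - (n : ℝ) + (C : ℝ)} := by
    simp only [Set.ofPred_and]
    repeat' apply IsClosed.inter
    all_goals exact isClosed_le (by fun_prop) (by fun_prop)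
  have hout := closure_minimal (fun R hR => DetZIC.IsAchievable.mem_outerBound hnm hR) hclosed
    (s := {R | DetZIC.IsAchievable m n C R})
  have hin := fun (R : ℝ × ℝ) (hR : 0 ≤ R.1 ∧ 0 ≤ R.2 ∧ R.1 ≤ (m : ℝ) ∧ R.2 ≤ (m : ℝ) ∧
      R.1 + R.2 ≤ 2 * (m : ℝ) - (n : ℝ) + (C : ℝ)) =>
    DetZIC.outerBound_subset hnm hR.1 hR.2.1 hR.2.2.1 hR.2.2.2.1 hR.2.2.2.2
  -- The inclusions secrecy region ⊆ capacity region ⊆ outer bound ⊆ secrecy region close into a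
  -- cycle.
  exact ⟨(hsub.trans hout).antisymm hin, (hout.trans hin).antisymm hsub⟩
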